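/- Let $\mathcal{G}_*$ be the space of rooted connected locally finite graphs up to root-preserving isomorphism $\cong$, with the distance $d_{loc}(G,G')=2^{-\sup\{r:\,B_r(G)\cong B_r(G')\}}$ and its Borel $\sigma$-algebra, where $B_r(G,v)$ denotes the subgraph of $G$ induced on the vertices at distance at most $r$ from $v$, rooted at $v$ (and $B_r(G)$ is the ball around the root of $G$). Let $G_n$, $n\ge 1$, be random graphs, where $n_1=n_1(n)=|V(G_n)|\ge 3$ is finite and non-random and $n_1\to\infty$ as $n\to\infty$. Let $G^*$ be a random element of $\mathcal{G}_*$, let $r^*$ be its root and let $d^*$ be the degree of $r^*$ in $G^*$. Suppose that $G_n\to G^*$ locally weakly in probability: for every integer $r\ge 0$ and every finite rooted connected graph $H$, \[ n_1^{-1}\bigl|\{v\in V(G_n): B_r(G_n,v)\cong H\}\bigr| \xrightarrow{\;p\;} \mathbb{P}(B_r(G^*)\cong H). \] Let $d_n$ be the degree in $G_n$ of a vertex chosen uniformly at random from $V(G_n)$ (given $G_n$), and suppose that $\mathbb{E}\,d_n^2\to\mathbb{E}\,(d^*)^2<\infty$. Let $k\ge 1$ be an integer with $\mathbb{P}(d^*=k)>0$.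 For a finite graph $G$ with at least three vertices, the conditional assortativity is \[ r_k(G)=\mathbb{E}\bigl(d_G(v_2)\,\big|\,v_1v_2\in E(G),\ d_G(v_1)=k\bigr), \] where $(v_1,v_2,v_3)$ is a uniformly random triple of distinct vertices of $G$, and $r_k(G)=0$ if the conditioning event has probability zero. Let $P_3'$ be the path on three vertices rooted at an endpoint, and let $\hom'(P_3',G,v)$ and $\mathrm{emb}'(P_3',G,v)$ be the numbers of homomorphisms, respectively of injective homomorphisms, from $P_3$ to $G$ that map the root of $P_3'$ to $v$. Then the expectations below are finite and, as $n\to\infty$, \[ r_k(G_n)\xrightarrow{\;p\;} r_k^*=\frac{\mathbb{E}\bigl[\mathbb{1}_{d^*=k}\hom'(P_3',G^*,r^*)\bigr]}{k\,\mathbb{P}(d^*=k)}=1+\frac{\mathbb{E}\bigl[\mathbb{1}_{d^*=k}\,\mathrm{emb}'(P_3',G^*,r^*)\bigr]}{k\,\mathbb{P}(d^*=k)}. \] -/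

import Mathlib

open Filter Topology MeasureTheory
open scoped BigOperators

noncomputable section

namespace LocalWeak

/-- A rooted connected locally finite graph. Connected locally finite graphs are countable, so
vertex sets in `Type` lose nothing. -/
structure RootedGraph where
  V : Type
  graph : SimpleGraph V
  root : V
  connected : graph.Connected
  locallyFinite : ∀ v, (graph.neighborSet v).Finite

/-- Root-preserving graph isomorphism. -/
def RootedGraph.Iso (G H : RootedGraph) : Prop :=
  ∃ e : G.graph ≃g H.graph, e G.root = H.root

theorem RootedGraph.Iso.refl (G : RootedGraph) : G.Iso G := ⟨.refl, rfl⟩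

theorem RootedGraph.Iso.symm {G H : RootedGraph} : G.Iso H → H.Iso G := by
  rintro ⟨e, he⟩
  exact ⟨e.symm, by rw [← he]; simp⟩

theorem RootedGraph.Iso.trans {G H K : RootedGraph} : G.Iso H → H.Iso K → G.Iso K := by
  rintro ⟨e, he⟩ ⟨f, hf⟩
  exact ⟨e.trans f, by simp [he, hf]⟩

instance rootedSetoid : Setoid RootedGraph where
  r := RootedGraph.Iso
  iseqv := ⟨.refl, .symm, .trans⟩

/-- The space `𝒢_*` of rooted connected locally finite graphs up to rooted isomorphism. -/
def RootedGraphSpace : Type 1 := Quotient rootedSetoid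

/-- The vertices of `G` at graph distance at most `r` from `v`. -/
def ballSet {V : Type*} (G : SimpleGraph V) (v : V) (r : ℕ) : Set V :=
  {u | G.edist v u ≤ (r : ℕ∞)}

theorem mem_ballSet {V : Type*} {G : SimpleGraph V} {v u : V} {r : ℕ} :
    u ∈ ballSet G v r ↔ ∃ p : G.Walk v u, p.length ≤ r := by
  constructor
  · intro h
    have hne : G.edist v u ≠ ⊤ := ne_top_of_le_ne_top (ENat.natCast_ne_top r) h
    obtain ⟨p, hp⟩ := SimpleGraph.exists_walk_of_edist_ne_top hne
    refine ⟨p, ?_⟩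
    have h' : G.edist v u ≤ (r : ℕ∞) := h
    rw [← hp] at h'
    exact_mod_cast h'
  · rintro ⟨p, hp⟩
    exact (SimpleGraph.edist_le p).trans (by exact_mod_cast hp)

theorem root_mem_ballSet {V : Type*} (G : SimpleGraph V) (v : V) (r : ℕ) :
    v ∈ ballSet G v r := mem_ballSet.2 ⟨.nil, by simp⟩

theorem support_subset_ballSet {V : Type*} {G : SimpleGraph V} {v u : V} {r : ℕ}
    (p : G.Walk v u) (hp : p.length ≤ r) : ∀ x ∈ p.support, x ∈ ballSet G v r := by
  classical
  intro x hx
  exact mem_ballSet.2 ⟨p.takeUntil x hx, (p.length_takeUntil_le_length hx).trans hp⟩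

theorem ball_connected {V : Type*} (G : SimpleGraph V) (v : V) (r : ℕ) :
    (G.induce (ballSet G v r)).Connected := by
  rw [SimpleGraph.connected_iff_exists_forall_reachable]
  refine ⟨⟨v, root_mem_ballSet G v r⟩, ?_⟩
  rintro ⟨u, hu⟩
  obtain ⟨p, hp⟩ := mem_ballSet.1 hu
  exact ⟨p.induce _ (support_subset_ballSet p hp)⟩

/-- `B_r(G, v)`: the subgraph of `G` induced on the vertices at distance at most `r` from `v`,
rooted at `v`. -/
def rootedBall {V : Type} (G : SimpleGraph V) (hG : ∀ u, (G.neighborSet u).Finite) (v : V)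
    (r : ℕ) : RootedGraph where
  V := ballSet G v r
  graph := G.induce (ballSet G v r)
  root := ⟨v, root_mem_ballSet G v r⟩
  connected := ball_connected G v r
  locallyFinite := fun u =>
    ((hG u.1).preimage Subtype.val_injective.injOn).subset fun _ hw => hw

/-- `B_r` on rooted graphs. -/
def RootedGraph.ball (G : RootedGraph) (r : ℕ) : RootedGraph :=
  rootedBall G.graph G.locallyFinite G.root r

theorem RootedGraph.Iso.ball {G H : RootedGraph} (h : G.Iso H) (r : ℕ) :
    (G.ball r).Iso (H.ball r) := by
  obtain ⟨e, he⟩ := h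
  have hb : Set.BijOn e (ballSet G.graph G.root r) (ballSet H.graph H.root r) := by
    refine ⟨?_, e.injective.injOn, ?_⟩
    · intro u hu
      obtain ⟨p, hp⟩ := mem_ballSet.1 hu
      rw [← he]
      exact mem_ballSet.2 ⟨p.map e.toHom, by simpa using hp⟩
    · intro w hw
      rw [← he] at hw
      obtain ⟨p, hp⟩ := mem_ballSet.1 hw
      refine ⟨e.symm w, mem_ballSet.2
        ⟨(p.map e.symm.toHom).copy (e.symm_apply_apply G.root) rfl, ?_⟩, by simp⟩
      simpa using hp
  exact ⟨e.induce hb, Subtype.ext he⟩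

/-- `B_r` as a map on `𝒢_*`. -/
def RootedGraphSpace.ball (x : RootedGraphSpace) (r : ℕ) : RootedGraphSpace :=
  Quotient.map (fun G : RootedGraph => G.ball r) (fun _ _ h => RootedGraph.Iso.ball h r) x

theorem RootedGraph.ball_ball (G : RootedGraph) {r s : ℕ} (hrs : r ≤ s) :
    ((G.ball s).ball r).Iso (G.ball r) := by
  have hto : ∀ u : ballSet G.graph G.root s,
      u ∈ ballSet (G.ball s).graph (G.ball s).root r ↔ u.1 ∈ ballSet G.graph G.root r := by
    intro u
    constructor
    · intro hu
      obtain ⟨p, hp⟩ := mem_ballSet.1 hu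
      exact mem_ballSet.2
        ⟨p.map (SimpleGraph.Embedding.induce (G := G.graph) (ballSet G.graph G.root s)).toHom,
          (SimpleGraph.Walk.length_map _ p).le.trans hp⟩
    · intro hu
      obtain ⟨p, hp⟩ := mem_ballSet.1 hu
      refine mem_ballSet.2 ⟨p.induce _ (support_subset_ballSet p (hp.trans hrs)), ?_⟩
      have := SimpleGraph.Walk.length_map
        (SimpleGraph.Embedding.induce (G := G.graph) (ballSet G.graph G.root s)).toHom
        (p.induce _ (support_subset_ballSet p (hp.trans hrs)))
      rw [SimpleGraph.Walk.map_induce] at this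
      exact this.symm.le.trans hp
  refine ⟨⟨⟨fun u => ⟨u.1.1, (hto u.1).1 u.2⟩,
    fun w => ⟨⟨w.1, ?_⟩, ?_⟩, fun _ => rfl, fun _ => rfl⟩, Iff.rfl⟩, rfl⟩
  · obtain ⟨p, hp⟩ := mem_ballSet.1 w.2
    exact mem_ballSet.2 ⟨p, hp.trans hrs⟩
  · exact (hto _).2 w.2

theorem RootedGraphSpace.ball_ball (x : RootedGraphSpace) {r s : ℕ} (hrs : r ≤ s) :
    (x.ball s).ball r = x.ball r := by
  induction x using Quotient.inductionOn with
  | h G => exact Quotient.sound (RootedGraph.ball_ball G hrs)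

theorem RootedGraphSpace.ball_zero (x y : RootedGraphSpace) : x.ball 0 = y.ball 0 := by
  induction x using Quotient.inductionOn with
  | h G =>
  induction y using Quotient.inductionOn with
  | h H =>
  have hs : ∀ K : RootedGraph, Subsingleton (K.ball 0).V := by
    intro K
    have key : ∀ a : (K.ball 0).V, a.1 = K.root := by
      rintro ⟨a, ha⟩
      obtain ⟨p, hp⟩ := mem_ballSet.1 ha
      exact (SimpleGraph.Walk.eq_of_length_eq_zero (Nat.le_zero.1 hp)).symm
    exact ⟨fun a b => Subtype.ext ((key a).trans (key b).symm)⟩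
  have hG := hs G
  have hH := hs H
  refine Quotient.sound ⟨⟨⟨fun _ => (H.ball 0).root, fun _ => (G.ball 0).root,
    fun _ => Subsingleton.elim _ _, fun _ => Subsingleton.elim _ _⟩, ?_⟩, rfl⟩
  intro a b
  have hab : a = b := Subsingleton.elim a b
  subst hab
  exact iff_of_false (SimpleGraph.irrefl _) (SimpleGraph.irrefl _)

/-- `d_loc(x, y) = 2 ^ (- sup {r : B_r(x) ≅ B_r(y)})`, written as the infimum of `2 ^ (-r)` over
the same set of `r` (which contains `0`), so that an infinite supremum gives distance `0`. -/
def dLoc (x y : RootedGraphSpace) : ℝ :=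
  sInf ((fun r : ℕ => (2⁻¹ : ℝ) ^ r) '' {r | x.ball r = y.ball r})

theorem dLoc_bddBelow (x y : RootedGraphSpace) :
    BddBelow ((fun r : ℕ => (2⁻¹ : ℝ) ^ r) '' {r | x.ball r = y.ball r}) :=
  ⟨0, by rintro _ ⟨r, -, rfl⟩; positivity⟩

theorem dLoc_nonempty (x y : RootedGraphSpace) :
    ((fun r : ℕ => (2⁻¹ : ℝ) ^ r) '' {r | x.ball r = y.ball r}).Nonempty :=
  ⟨_, 0, RootedGraphSpace.ball_zero x y, rfl⟩

theorem dLoc_nonneg (x y : RootedGraphSpace) : 0 ≤ dLoc x y :=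
  le_csInf (dLoc_nonempty x y) (by rintro _ ⟨r, -, rfl⟩; positivity)

theorem dLoc_self (x : RootedGraphSpace) : dLoc x x = 0 := by
  refine le_antisymm (le_of_forall_pos_lt_add fun ε hε => ?_) (dLoc_nonneg x x)
  obtain ⟨r, hr⟩ := exists_pow_lt_of_lt_one hε (by norm_num : (2⁻¹ : ℝ) < 1)
  rw [zero_add]
  exact (csInf_le (dLoc_bddBelow x x) ⟨r, rfl, rfl⟩).trans_lt hr

theorem dLoc_comm (x y : RootedGraphSpace) : dLoc x y = dLoc y x := by
  unfold dLoc
  simp_rw [eq_comm]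

theorem dLoc_triangle (x y z : RootedGraphSpace) : dLoc x z ≤ dLoc x y + dLoc y z := by
  refine le_of_forall_pos_lt_add fun ε hε => ?_
  obtain ⟨_, ⟨r, hr, rfl⟩, hr'⟩ :=
    exists_lt_of_csInf_lt (dLoc_nonempty x y) (lt_add_of_pos_right _ (half_pos hε))
  obtain ⟨_, ⟨s, hs, rfl⟩, hs'⟩ :=
    exists_lt_of_csInf_lt (dLoc_nonempty y z) (lt_add_of_pos_right _ (half_pos hε))
  have hm : x.ball (min r s) = z.ball (min r s) := by
    have h1 : x.ball (min r s) = y.ball (min r s) := by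
      rw [← x.ball_ball (min_le_left r s), ← y.ball_ball (min_le_left r s),
        show x.ball r = y.ball r from hr]
    have h2 : y.ball (min r s) = z.ball (min r s) := by
      rw [← y.ball_ball (min_le_right r s), ← z.ball_ball (min_le_right r s),
        show y.ball s = z.ball s from hs]
    exact h1.trans h2
  have hle : dLoc x z ≤ (2⁻¹ : ℝ) ^ (min r s) := csInf_le (dLoc_bddBelow x z) ⟨_, hm, rfl⟩
  have hsum : (2⁻¹ : ℝ) ^ (min r s) ≤ (2⁻¹ : ℝ) ^ r + (2⁻¹ : ℝ) ^ s := by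
    rcases min_choice r s with h | h <;> rw [h]
    · exact le_add_of_nonneg_right (by positivity)
    · exact le_add_of_nonneg_left (by positivity)
  change (2⁻¹ : ℝ) ^ r < dLoc x y + ε / 2 at hr'
  change (2⁻¹ : ℝ) ^ s < dLoc y z + ε / 2 at hs'
  linarith

/-- The topology of `d_loc` on `𝒢_*`. -/
instance : PseudoMetricSpace RootedGraphSpace where
  dist := dLoc
  dist_self := dLoc_self
  dist_comm := dLoc_comm
  dist_triangle := dLoc_triangle

/-- The Borel σ-algebra of `(𝒢_*, d_loc)`. -/
instance : MeasurableSpace RootedGraphSpace := borel RootedGraphSpace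

instance : BorelSpace RootedGraphSpace := ⟨rfl⟩

/-- `p_r(G, H)`: the fraction of vertices `v` of the finite graph `G` with `B_r(G, v) ≅ H`. -/
def ballFraction {V : Type} [Finite V] (G : SimpleGraph V) (r : ℕ) (H : RootedGraph) : ℝ :=
  ({v | (rootedBall G (fun _ => Set.toFinite _) v r).Iso H}.ncard : ℝ) / (Nat.card V : ℝ)

/-- Local weak convergence in probability of random finite graphs `G n` to the random rooted graph
`Gs`: for every `r` and every finite rooted connected graph `H`, `p_r(G n, H)` converges in
probability to the probability that `B_r(Gs) ≅ H`. -/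
def TendstoLocallyInProbability {Ω Ω' : Type*} [MeasurableSpace Ω] [MeasurableSpace Ω']
    (P : Measure Ω) (P' : Measure Ω') {V : ℕ → Type} [∀ n, Finite (V n)]
    (G : ∀ n, Ω → SimpleGraph (V n)) (Gs : Ω' → RootedGraphSpace) : Prop :=
  ∀ (r : ℕ) (H : RootedGraph), Finite H.V →
    TendstoInMeasure P (fun n ω => ballFraction (G n ω) r H) atTop
      (fun _ => P'.real {ω | (Gs ω).ball r = (Quotient.mk rootedSetoid H : RootedGraphSpace)})

/-- The degree of a vertex (in a locally finite graph). -/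
def deg {V : Type*} (G : SimpleGraph V) (v : V) : ℕ := (G.neighborSet v).ncard

/-- `hom'((H, w), G, v)`: the number of homomorphisms from `H` to `G` that map `w` to `v`. -/
def homRooted {W V : Type*} (H : SimpleGraph W) (w : W) (G : SimpleGraph V) (v : V) : ℕ :=
  Nat.card {f : H →g G // f w = v}

/-- `emb'((H, w), G, v)`: the number of injective homomorphisms from `H` to `G` that map `w`
to `v`. -/
def embRooted {W V : Type*} (H : SimpleGraph W) (w : W) (G : SimpleGraph V) (v : V) : ℕ :=
  Nat.card {f : H →g G // Function.Injective f ∧ f w = v}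

theorem deg_iso {V V' : Type*} {G : SimpleGraph V} {G' : SimpleGraph V'} (e : G ≃g G') (v : V) :
    deg G v = deg G' (e v) :=
  Nat.card_congr (e.mapNeighborSet v)

theorem homRooted_iso {W V V' : Type*} (H : SimpleGraph W) (w : W) {G : SimpleGraph V}
    {G' : SimpleGraph V'} (e : G ≃g G') (v : V) :
    homRooted H w G v = homRooted H w G' (e v) :=
  Nat.card_congr
    { toFun := fun f => ⟨e.toHom.comp f.1, congrArg e f.2⟩
      invFun := fun f => ⟨e.symm.toHom.comp f.1,
        (congrArg e.symm f.2).trans (e.symm_apply_apply v)⟩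
      left_inv := fun f => Subtype.ext (RelHom.ext fun a => e.symm_apply_apply (f.1 a))
      right_inv := fun f => Subtype.ext (RelHom.ext fun a => e.apply_symm_apply (f.1 a)) }

theorem embRooted_iso {W V V' : Type*} (H : SimpleGraph W) (w : W) {G : SimpleGraph V}
    {G' : SimpleGraph V'} (e : G ≃g G') (v : V) :
    embRooted H w G v = embRooted H w G' (e v) :=
  Nat.card_congr
    { toFun := fun f => ⟨e.toHom.comp f.1, e.injective.comp f.2.1, congrArg e f.2.2⟩
      invFun := fun f => ⟨e.symm.toHom.comp f.1, e.symm.injective.comp f.2.1,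
        (congrArg e.symm f.2.2).trans (e.symm_apply_apply v)⟩
      left_inv := fun f => Subtype.ext (RelHom.ext fun a => e.symm_apply_apply (f.1 a))
      right_inv := fun f => Subtype.ext (RelHom.ext fun a => e.apply_symm_apply (f.1 a)) }

/-- The degree of the root. -/
def RootedGraphSpace.rootDeg (x : RootedGraphSpace) : ℕ :=
  Quotient.lift (fun G : RootedGraph => deg G.graph G.root)
    (by rintro G H ⟨e, he⟩; rw [← he]; exact deg_iso e G.root) x

/-- `hom'((H, w), G, root of G)` for a class `[G]` in `𝒢_*`. -/
def RootedGraphSpace.homRoot {W : Type*} (H : SimpleGraph W) (w : W) (x : RootedGraphSpace) : ℕ :=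
  Quotient.lift (fun G : RootedGraph => homRooted H w G.graph G.root)
    (by rintro G K ⟨e, he⟩; rw [← he]; exact homRooted_iso H w e G.root) x

/-- `emb'((H, w), G, root of G)` for a class `[G]` in `𝒢_*`. -/
def RootedGraphSpace.embRoot {W : Type*} (H : SimpleGraph W) (w : W) (x : RootedGraphSpace) : ℕ :=
  Quotient.lift (fun G : RootedGraph => embRooted H w G.graph G.root)
    (by rintro G K ⟨e, he⟩; rw [← he]; exact embRooted_iso H w e G.root) x

open Classical in
/-- The conditional assortativity
`r_k(G) = E(d(v₂) | v₁ v₂ ∈ G, d(v₁) = k) = E(d(v₂) 1_A) / P(A)`, where `(v₁, v₂, v₃)` is a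
uniformly random triple of distinct vertices of `G` and `A = {v₁ v₂ ∈ G, d(v₁) = k}`; it is `0`
when `P(A) = 0`. -/
def condAssortativity {V : Type*} [Fintype V] (k : ℕ) (G : SimpleGraph V) : ℝ :=
  (𝔼 t : Fin 3 ↪ V, if G.Adj (t 0) (t 1) ∧ deg G (t 0) = k then (deg G (t 1) : ℝ) else 0) /
    (𝔼 t : Fin 3 ↪ V, if G.Adj (t 0) (t 1) ∧ deg G (t 0) = k then (1 : ℝ) else 0)

end LocalWeak

end

namespace LocalWeak

/-! In a finite graph, the homomorphisms from `P₃'` at `v` number `∑ d(u)` over neighbours `u` of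
`v`. Hence `r_k(G)` is a quotient of two vertex averages: that of `1_{d(v)=k} hom'(P₃', G, v)` over
`k` times that of `1_{d(v)=k}` (`condAssortativity_eq`). Both summands depend only on `B_2(G, v)`.

For a bounded function of the ball, the vertex average converges in L¹ to the expectation in the
limit: finitely many ball classes carry almost all the mass, and on each of them the hypothesis
applies (`TendstoLocallyInProbability.tendsto_integral_abs_sub`). This settles the denominator.

The numerator is unbounded, so the path count is truncated at `kM`. At a vertex of degree `k`, the
excess is at most the sum of the degrees above `M` among its neighbours. Summed over all vertices by
double counting, this is at most `∑ d(u)² 1_{d(u)>M}` (`sum_homRooted_sub_min_le`). Convergence of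
the second moment makes the mean of this tail tend to `E (d*)² 1_{d*>M}`, which is small for large
`M`.

The second formula holds because the non-injective homomorphisms are the walks `v, u, v`, one for
each neighbour `u`. -/

/-! ### Degrees and rooted path counts as functions of balls. -/

theorem self_mem_ballSet_of_adj {V : Type*} {G : SimpleGraph V} {v u : V} {r : ℕ} (hr : 1 ≤ r)
    (h : G.Adj v u) : u ∈ ballSet G v r :=
  mem_ballSet.2 ⟨h.toWalk, by simpa using hr⟩

theorem mem_ballSet_of_adj_adj {V : Type*} {G : SimpleGraph V} {v u w : V} {r : ℕ} (hr : 2 ≤ r)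
    (h : G.Adj v u) (h' : G.Adj u w) : w ∈ ballSet G v r :=
  mem_ballSet.2 ⟨.cons h h'.toWalk, by simpa using hr⟩

/-- The degree of the root is determined by a ball of positive radius. -/
theorem deg_rootedBall {V : Type} (G : SimpleGraph V) (hG : ∀ u, (G.neighborSet u).Finite) (v : V)
    {r : ℕ} (hr : 1 ≤ r) :
    deg (rootedBall G hG v r).graph (rootedBall G hG v r).root = deg G v :=
  Nat.card_congr
    { toFun := fun u => ⟨u.1.1, u.2⟩
      invFun := fun u => ⟨⟨u.1, self_mem_ballSet_of_adj hr u.2⟩, u.2⟩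
      left_inv := fun _ => rfl
      right_inv := fun _ => rfl }

/-- Homomorphisms of the path `0 - 1 - 2` with `0 ↦ v` are pairs of consecutive edges
starting at `v`. -/
def pathHomEquiv {V : Type*} (G : SimpleGraph V) (v : V) :
    {f : SimpleGraph.pathGraph 3 →g G // f 0 = v} ≃
      Σ u : G.neighborSet v, G.neighborSet u.1 where
  toFun f := ⟨⟨f.1 1, by
      have h := f.1.map_adj (show (SimpleGraph.pathGraph 3).Adj 0 1 by
        simp [SimpleGraph.pathGraph_adj])
      rwa [f.2] at h⟩,
    ⟨f.1 2, f.1.map_adj (show (SimpleGraph.pathGraph 3).Adj 1 2 by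
        simp [SimpleGraph.pathGraph_adj])⟩⟩
  invFun p := ⟨⟨![v, p.1.1, p.2.1], by
      have h1 : G.Adj v p.1.1 := p.1.2
      have h2 : G.Adj p.1.1 p.2.1 := p.2.2
      intro a b hab
      rw [SimpleGraph.pathGraph_adj] at hab
      fin_cases a <;> fin_cases b <;> simp_all [SimpleGraph.adj_comm]⟩, rfl⟩
  left_inv f := by
    obtain ⟨f, rfl⟩ := f
    refine Subtype.ext (RelHom.ext fun a => ?_)
    fin_cases a <;> rfl
  right_inv _ := rfl

theorem homRooted_path_eq_card {V : Type*} (G : SimpleGraph V) (v : V) :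
    homRooted (SimpleGraph.pathGraph 3) 0 G v =
      Nat.card (Σ u : G.neighborSet v, G.neighborSet u.1) :=
  Nat.card_congr (pathHomEquiv G v)

/-- The number of homomorphisms of the rooted path on three vertices is determined by a ball of
radius at least two. -/
theorem homRooted_path_rootedBall {V : Type} (G : SimpleGraph V)
    (hG : ∀ u, (G.neighborSet u).Finite) (v : V) {r : ℕ} (hr : 2 ≤ r) :
    homRooted (SimpleGraph.pathGraph 3) 0 (rootedBall G hG v r).graph (rootedBall G hG v r).root =
      homRooted (SimpleGraph.pathGraph 3) 0 G v := by
  rw [homRooted_path_eq_card, homRooted_path_eq_card]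
  exact Nat.card_congr
    { toFun := fun p => ⟨⟨p.1.1.1, p.1.2⟩, ⟨p.2.1.1, p.2.2⟩⟩
      invFun := fun p => ⟨⟨⟨p.1.1, self_mem_ballSet_of_adj (by omega) p.1.2⟩, p.1.2⟩,
        ⟨⟨p.2.1, mem_ballSet_of_adj_adj hr p.1.2 p.2.2⟩, p.2.2⟩⟩
      left_inv := fun _ => rfl
      right_inv := fun _ => rfl }

theorem homRooted_path_eq_sum {V : Type*} [Fintype V] (G : SimpleGraph V) [DecidableRel G.Adj]
    (v : V) :
    homRooted (SimpleGraph.pathGraph 3) 0 G v = ∑ u, if G.Adj v u then deg G u else 0 := by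
  classical
  rw [homRooted_path_eq_card, Nat.card_sigma, ← Finset.sum_filter]
  refine (Finset.sum_subtype (p := fun u => u ∈ G.neighborSet v) (F := inferInstance) _
    (fun u => by simp) (fun u => deg G u)).symm

/-- A homomorphism of the path `0 - 1 - 2` is injective unless it is a step and its reversal. -/
theorem homRooted_path_eq_embRooted_add_deg {V : Type*} (G : SimpleGraph V)
    (hG : ∀ u, (G.neighborSet u).Finite) (v : V) :
    homRooted (SimpleGraph.pathGraph 3) 0 G v =
      embRooted (SimpleGraph.pathGraph 3) 0 G v + deg G v := by
  classical
  have hfin : Finite {f : SimpleGraph.pathGraph 3 →g G // f 0 = v} := by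
    have (u : V) : Finite (G.neighborSet u) := hG u
    exact Finite.of_equiv _ (pathHomEquiv G v).symm
  -- The two edges already separate 0 from 1 and 1 from 2, so only the endpoints can collide.
  have hinj (f : SimpleGraph.pathGraph 3 →g G) : Function.Injective f ↔ f 2 ≠ f 0 := by
    have h1 : f 0 ≠ f 1 := (f.map_adj (show (SimpleGraph.pathGraph 3).Adj 0 1 by
        simp [SimpleGraph.pathGraph_adj])).ne
    have h2 : f 1 ≠ f 2 := (f.map_adj (show (SimpleGraph.pathGraph 3).Adj 1 2 by
        simp [SimpleGraph.pathGraph_adj])).ne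
    refine ⟨fun h => h.ne (by decide), fun h a b hab => ?_⟩
    fin_cases a <;> fin_cases b <;> simp_all [eq_comm]
  have e1 : {f : SimpleGraph.pathGraph 3 →g G // Function.Injective f ∧ f 0 = v} ≃
      {f : {f : SimpleGraph.pathGraph 3 →g G // f 0 = v} // f.1 2 ≠ v} :=
    { toFun := fun f => ⟨⟨f.1, f.2.2⟩, fun h => (hinj _).1 f.2.1 (h.trans f.2.2.symm)⟩
      invFun := fun f => ⟨f.1.1, (hinj _).2 fun h => f.2 (h.trans f.1.2), f.1.2⟩
      left_inv := fun _ => rfl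
      right_inv := fun _ => rfl }
  have e2 : G.neighborSet v ≃
      {f : {f : SimpleGraph.pathGraph 3 →g G // f 0 = v} // ¬ f.1 2 ≠ v} :=
    { toFun := fun u => ⟨(pathHomEquiv G v).symm ⟨u, ⟨v, G.adj_symm u.2⟩⟩, fun h => h rfl⟩
      invFun := fun f => (pathHomEquiv G v f.1).1
      left_inv := fun _ => rfl
      right_inv := fun f => by
        obtain ⟨f, hf⟩ := f
        refine Subtype.ext ?_
        apply (pathHomEquiv G v).injective
        rw [Equiv.apply_symm_apply]
        refine Sigma.ext rfl (heq_of_eq (Subtype.ext ?_))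
        exact (not_not.1 hf).symm }
  unfold homRooted embRooted deg
  rw [Nat.card_congr e1, ← Nat.card_coe_set_eq, Nat.card_congr e2, ← Nat.card_sum]
  exact Nat.card_congr (Equiv.sumCompl _).symm

namespace RootedGraphSpace

theorem rootDeg_ball (x : RootedGraphSpace) {r : ℕ} (hr : 1 ≤ r) :
    (x.ball r).rootDeg = x.rootDeg := by
  induction x using Quotient.inductionOn with
  | h H => exact deg_rootedBall H.graph H.locallyFinite H.root hr

theorem homRoot_path_ball (x : RootedGraphSpace) {r : ℕ} (hr : 2 ≤ r) :
    (x.ball r).homRoot (SimpleGraph.pathGraph 3) 0 = x.homRoot (SimpleGraph.pathGraph 3) 0 := by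
  induction x using Quotient.inductionOn with
  | h H => exact homRooted_path_rootedBall H.graph H.locallyFinite H.root hr

theorem homRoot_path_eq (x : RootedGraphSpace) :
    x.homRoot (SimpleGraph.pathGraph 3) 0 =
      x.embRoot (SimpleGraph.pathGraph 3) 0 + x.rootDeg := by
  induction x using Quotient.inductionOn with
  | h H => exact homRooted_path_eq_embRooted_add_deg H.graph H.locallyFinite H.root

end RootedGraphSpace

/-! ### Conditional assortativity as a quotient of vertex averages. -/

/-- Summing over triples of distinct points a function of the first two coordinates. -/
theorem sum_embedding_fin_three {V : Type*} [Fintype V] [DecidableEq V] (g : V → V → ℝ) :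
    ∑ t : Fin 3 ↪ V, g (t 0) (t 1) =
      ((Fintype.card V : ℝ) - 2) * ∑ u, ∑ v, if u = v then 0 else g u v := by
  have hcard {m : ℕ} (e : Fin m ↪ V) :
      (Fintype.card {i // i ∉ Set.range e} : ℝ) = (Fintype.card V : ℝ) - m := by
    have h := Fintype.card_subtype_compl (fun i => i ∈ Set.range e)
    have h2 : Fintype.card {i // i ∈ Set.range e} = m := by
      rw [← Fintype.card_congr (Equiv.ofInjective e e.injective), Fintype.card_fin]
    have h3 : m ≤ Fintype.card V := by
      simpa using Fintype.card_le_of_embedding e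
    rw [h, h2, Nat.cast_sub h3]
  -- `Equiv.embeddingFinSucc` splits off coordinate 0, so the triple is reversed to make that the
  -- free one; it then has `card V - 2` possible values.
  have h1 : ∑ t : Fin 3 ↪ V, g (t 0) (t 1) = ∑ t : Fin 3 ↪ V, g (t 2) (t 1) :=
    Fintype.sum_equiv (Equiv.embeddingCongr Fin.revPerm (Equiv.refl V)) _ _ fun t => by
      simp [Equiv.embeddingCongr]
  have h2 : ∑ t : Fin 3 ↪ V, g (t 2) (t 1) =
      ∑ p : (Σ e : Fin 2 ↪ V, {i // i ∉ Set.range e}), g (p.1 1) (p.1 0) :=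
    Fintype.sum_equiv (Equiv.embeddingFinSucc 2 V) _ _ fun t => rfl
  have h3 : ∑ t : Fin 2 ↪ V, g (t 1) (t 0) =
      ∑ p : (Σ e : Fin 1 ↪ V, {i // i ∉ Set.range e}), g (p.1 0) p.2.1 :=
    Fintype.sum_equiv (Equiv.embeddingFinSucc 1 V) _ _ fun t => rfl
  rw [h1, h2, Fintype.sum_sigma]
  simp_rw [Finset.sum_const, Finset.card_univ, nsmul_eq_mul, hcard]
  rw [← Finset.mul_sum, h3, Fintype.sum_sigma]
  congr 1
  refine Fintype.sum_equiv (Equiv.uniqueEmbeddingEquivResult (α := Fin 1) (β := V))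
    _ _ fun e => ?_
  have he : Equiv.uniqueEmbeddingEquivResult e = e 0 := rfl
  rw [he]
  rw [← Finset.sum_subtype (p := fun v => v ∉ Set.range e) (F := inferInstance)
    (Finset.univ.filter fun v => e 0 ≠ v) (fun v => by simp) (fun v => g (e 0) v),
    Finset.sum_filter]
  exact Finset.sum_congr rfl fun v _ => by split_ifs <;> simp_all

open Classical in
/-- The conditional assortativity as a quotient of averages over vertices. -/
theorem condAssortativity_eq {V : Type*} [Fintype V] (hV : 3 ≤ Fintype.card V) (k : ℕ)
    (G : SimpleGraph V) :
    condAssortativity k G =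
      (𝔼 v, if deg G v = k then (homRooted (SimpleGraph.pathGraph 3) 0 G v : ℝ) else 0) /
        (k * 𝔼 v, if deg G v = k then (1 : ℝ) else 0) := by
  have hdeg (v : V) : deg G v = (Finset.univ.filter fun u => G.Adj v u).card := by
    rw [deg, Set.ncard_eq_toFinset_card']
    congr 1
    ext u
    simp
  have hne : ((Fintype.card V : ℝ) - 2) ≠ 0 := by
    have : (3 : ℝ) ≤ Fintype.card V := by exact_mod_cast hV
    linarith
  -- The prefactor does not depend on `h` and is nonzero as there are at least three vertices, so it
  -- cancels in the quotient, even when the conditioning event is null.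
  have key (h : V → ℝ) : (𝔼 t : Fin 3 ↪ V,
      if G.Adj (t 0) (t 1) ∧ deg G (t 0) = k then h (t 1) else 0) =
      (((Fintype.card V : ℝ) - 2) / Fintype.card (Fin 3 ↪ V)) *
        ∑ u, if deg G u = k then ∑ v, if G.Adj u v then h v else 0 else 0 := by
    rw [Fintype.expect_eq_sum_div_card, sum_embedding_fin_three
      (fun u v => if G.Adj u v ∧ deg G u = k then h v else 0), mul_div_right_comm]
    congr 1
    refine Finset.sum_congr rfl fun u _ => ?_
    by_cases hu : deg G u = k
    · simp only [hu, and_true, if_true]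
      refine Finset.sum_congr rfl fun v _ => ?_
      by_cases huv : u = v
      · subst huv; simp
      · simp [huv]
    · simp [hu]
  have hne' : (Fintype.card (Fin 3 ↪ V) : ℝ) ≠ 0 := by
    have : Nonempty (Fin 3 ↪ V) := Function.Embedding.nonempty_of_card_le (by simpa using hV)
    exact_mod_cast Fintype.card_ne_zero
  have hneV : (Fintype.card V : ℝ) ≠ 0 := by
    have : Fintype.card V ≠ 0 := by omega
    exact_mod_cast this
  unfold condAssortativity
  rw [key fun v => (deg G v : ℝ), key fun _ => 1, mul_div_mul_left _ _ (div_ne_zero hne hne'),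
    Fintype.expect_eq_sum_div_card, Fintype.expect_eq_sum_div_card, ← mul_div_assoc,
    div_div_div_cancel_right₀ hneV, Finset.mul_sum]
  congr 1
  · refine Finset.sum_congr rfl fun u _ => ?_
    rw [homRooted_path_eq_sum]
    push_cast
    rfl
  · refine Finset.sum_congr rfl fun u _ => ?_
    by_cases hu : deg G u = k
    · simp [hu, ← hdeg]
    · simp [hu]

/-! ### Truncation error controlled by large degrees. -/

open Classical in
/-- The excess of the number of rooted paths over a truncation, at vertices of degree `k`, is
controlled by the large degrees. -/
theorem sum_homRooted_sub_min_le {V : Type*} [Fintype V] (k M : ℕ) (G : SimpleGraph V) :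
    (∑ v, if deg G v = k then ((homRooted (SimpleGraph.pathGraph 3) 0 G v : ℝ) -
        min (homRooted (SimpleGraph.pathGraph 3) 0 G v : ℝ) (k * M)) else 0) ≤
      ∑ v, ((deg G v : ℝ) ^ 2 - if deg G v ≤ M then (deg G v : ℝ) ^ 2 else 0) := by
  have hdeg (v : V) : deg G v = (Finset.univ.filter fun u => G.Adj v u).card := by
    rw [deg, Set.ncard_eq_toFinset_card']
    congr 1
    ext u
    simp
  set b : V → ℝ := fun u => if deg G u ≤ M then 0 else deg G u with hb
  have hb0 (u : V) : 0 ≤ b u := by simp only [hb]; split_ifs <;> positivity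
  have hle (u : V) : (deg G u : ℝ) ≤ b u + M := by
    simp only [hb]
    split_ifs with h
    · simpa using (Nat.cast_le (α := ℝ)).2 h
    · simp
  have h1 (v : V) : (if deg G v = k then ((homRooted (SimpleGraph.pathGraph 3) 0 G v : ℝ) -
        min (homRooted (SimpleGraph.pathGraph 3) 0 G v : ℝ) (k * M)) else 0) ≤
      ∑ u, if G.Adj v u then b u else 0 := by
    have hs : 0 ≤ ∑ u, if G.Adj v u then b u else 0 :=
      Finset.sum_nonneg fun u _ => by split_ifs <;> simp [hb0]
    split_ifs with hv
    · have h2 : (homRooted (SimpleGraph.pathGraph 3) 0 G v : ℝ) ≤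
          (∑ u, if G.Adj v u then b u else 0) + k * M := by
        rw [homRooted_path_eq_sum, ← hv, hdeg v, ← Finset.sum_filter, ← Finset.sum_filter,
          ← nsmul_eq_mul, ← Finset.sum_const, ← Finset.sum_add_distrib]
        push_cast
        exact Finset.sum_le_sum fun u _ => hle u
      rcases min_choice (homRooted (SimpleGraph.pathGraph 3) 0 G v : ℝ) (k * M) with h | h <;>
        rw [h] <;> linarith
    · exact hs
  refine (Finset.sum_le_sum fun v _ => h1 v).trans ?_
  -- Double counting: `u` contributes `b u` to each of its `deg G u` neighbours.
  rw [Finset.sum_comm]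
  refine Finset.sum_le_sum fun u _ => ?_
  have h3 : (∑ v, if G.Adj v u then b u else 0) = deg G u * b u := by
    rw [hdeg u, ← Finset.sum_filter, Finset.sum_const, nsmul_eq_mul]
    simp_rw [G.adj_comm]
  rw [h3]
  simp only [hb]
  split_ifs <;> simp [sq]

/-! ### Finite balls, countably many classes, measurability. -/

theorem ballSet_finite {V : Type*} (G : SimpleGraph V) (hG : ∀ u, (G.neighborSet u).Finite)
    (v : V) (r : ℕ) : (ballSet G v r).Finite := by
  induction r generalizing v with
  | zero =>
    refine (Set.finite_singleton v).subset fun u hu => ?_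
    obtain ⟨p, hp⟩ := mem_ballSet.1 hu
    exact (SimpleGraph.Walk.eq_of_length_eq_zero (Nat.le_zero.1 hp)).symm
  | succ r ih =>
    refine ((Set.finite_singleton v).union ((hG v).biUnion fun u _ => ih u)).subset fun u hu => ?_
    obtain ⟨p, hp⟩ := mem_ballSet.1 hu
    cases p with
    | nil => exact Or.inl rfl
    | cons h q =>
      refine Or.inr (Set.mem_biUnion h (mem_ballSet.2 ⟨q, ?_⟩))
      simpa using hp

/-- The isomorphism classes of finite rooted connected graphs. -/
def finiteClasses : Set RootedGraphSpace :=
  {x | ∃ H : RootedGraph, Finite H.V ∧ (Quotient.mk rootedSetoid H : RootedGraphSpace) = x}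

theorem ball_mem_finiteClasses (x : RootedGraphSpace) (r : ℕ) : x.ball r ∈ finiteClasses := by
  induction x using Quotient.inductionOn with
  | h H => exact ⟨H.ball r, ballSet_finite H.graph H.locallyFinite H.root r, rfl⟩

/-- Each class has a representative on some `Fin n`, and each `n` allows only finitely many rooted
graphs. -/
theorem finiteClasses_countable : finiteClasses.Countable := by
  let T := Σ n : ℕ, {p : SimpleGraph (Fin n) × Fin n // p.1.Connected}
  have : Countable T := inferInstance
  let F : T → RootedGraphSpace := fun t => Quotient.mk rootedSetoid
    ⟨Fin t.1, t.2.1.1, t.2.1.2, t.2.2, fun _ => Set.toFinite _⟩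
  refine (Set.countable_range F).mono ?_
  rintro _ ⟨H, hH, rfl⟩
  obtain ⟨n, ⟨e⟩⟩ := Finite.exists_equiv_fin H.V
  let e' : H.graph ≃g H.graph.map e.toEmbedding := SimpleGraph.Iso.map e H.graph
  refine ⟨⟨n, (H.graph.map e.toEmbedding, e H.root), ?_⟩, ?_⟩
  · exact e'.connected_iff.1 H.connected
  · exact (Quotient.sound ⟨e', rfl⟩ : (Quotient.mk rootedSetoid H : RootedGraphSpace) = _).symm

/-- Points at distance less than `2⁻¹ ^ r` have the same `r`-ball, so `B_r` is locally constant and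
any function of it is Borel. -/
theorem RootedGraphSpace.isOpen_ball_mem (r : ℕ) (S : Set RootedGraphSpace) :
    IsOpen {x : RootedGraphSpace | x.ball r ∈ S} := by
  rw [Metric.isOpen_iff]
  intro x hx
  refine ⟨2⁻¹ ^ r, by positivity, fun y hy => ?_⟩
  obtain ⟨_, ⟨s, hs, rfl⟩, hlt⟩ := exists_lt_of_csInf_lt (dLoc_nonempty y x) hy
  have hrs : r < s := (pow_lt_pow_iff_right_of_lt_one₀ (by norm_num) (by norm_num)).1 hlt
  have h : y.ball r = x.ball r := by
    rw [← y.ball_ball hrs.le, ← x.ball_ball hrs.le, show y.ball s = x.ball s from hs]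
  change y.ball r ∈ S
  rw [h]
  exact hx

theorem RootedGraphSpace.measurable_comp_ball {β : Type*} [MeasurableSpace β] (r : ℕ)
    (φ : RootedGraphSpace → β) : Measurable fun x : RootedGraphSpace => φ (x.ball r) :=
  fun S _ => (RootedGraphSpace.isOpen_ball_mem r (φ ⁻¹' S)).measurableSet

/-- Every function of a random graph on a finite vertex set is measurable. -/
theorem measurable_comp_simpleGraph {Ω V β : Type*} [MeasurableSpace Ω] [MeasurableSpace β]
    [Finite V] {G : Ω → SimpleGraph V} (hG : Measurable G) (g : SimpleGraph V → β) :
    Measurable fun ω => g (G ω) := by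
  classical
  refine Measurable.comp (fun S _ => ?_) hG
  -- The σ-algebra on graphs is pulled back along the injective map `Adj` into a finite space.
  refine ⟨SimpleGraph.Adj '' (g ⁻¹' S), ?_, ?_⟩
  · have : Finite (V → V → Prop) := inferInstance
    exact (Set.toFinite _).measurableSet
  · exact Set.preimage_image_eq _ fun _ _ h => SimpleGraph.ext h

theorem integrable_comp_simpleGraph {Ω V : Type*} [MeasurableSpace Ω] [Finite V]
    {P : Measure Ω} [IsFiniteMeasure P] {G : Ω → SimpleGraph V} (hG : Measurable G)
    (g : SimpleGraph V → ℝ) : Integrable (fun ω => g (G ω)) P := by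
  obtain ⟨C, hC⟩ := (Set.toFinite (Set.range fun K : SimpleGraph V => ‖g K‖)).bddAbove
  exact Integrable.of_bound (measurable_comp_simpleGraph hG g).aestronglyMeasurable C
    (ae_of_all _ fun ω => hC ⟨G ω, rfl⟩)

/-- The class of `B_r(G, v)`. -/
def ballClass {V : Type} [Finite V] (G : SimpleGraph V) (r : ℕ) (v : V) : RootedGraphSpace :=
  Quotient.mk rootedSetoid (rootedBall G (fun _ => Set.toFinite _) v r)

open Classical in
theorem ballFraction_eq_expect {V : Type} [Fintype V] (G : SimpleGraph V) (r : ℕ)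
    (H : RootedGraph) :
    ballFraction G r H = 𝔼 v, if ballClass G r v = Quotient.mk rootedSetoid H then 1 else 0 := by
  rw [Fintype.expect_eq_sum_div_card, Finset.sum_boole, ballFraction, Nat.card_eq_fintype_card]
  congr 2
  rw [Set.ncard_eq_toFinset_card']
  congr 1
  ext v
  simp only [Set.mem_toFinset, Set.mem_ofPred_eq, Finset.mem_filter, Finset.mem_univ, true_and]
  exact Quotient.eq (r := rootedSetoid).symm

/-! ### Convergence in measure and in mean. -/

/-- Bounded convergence in measure to a constant gives convergence in mean. -/
theorem tendsto_integral_abs_sub_of_tendstoInMeasure {Ω : Type*} [MeasurableSpace Ω]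
    {P : Measure Ω} [IsProbabilityMeasure P] {X : ℕ → Ω → ℝ} {c C : ℝ}
    (hX : ∀ n, Measurable (X n)) (hC : ∀ n ω, |X n ω - c| ≤ C)
    (h : TendstoInMeasure P X atTop fun _ => c) :
    Tendsto (fun n => ∫ ω, |X n ω - c| ∂P) atTop (𝓝 0) := by
  rw [tendstoInMeasure_iff_measureReal_norm] at h
  have hm (n : ℕ) : Measurable fun ω => |X n ω - c| :=
    continuous_abs.measurable.comp ((hX n).sub_const c)
  have hC0 : 0 ≤ C := by
    obtain ⟨ω⟩ := nonempty_of_isProbabilityMeasure P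
    exact (abs_nonneg _).trans (hC 0 ω)
  have hle (ε : ℝ) (hε : 0 < ε) (n : ℕ) :
      ∫ ω, |X n ω - c| ∂P ≤ ε + C * P.real {ω | ε ≤ ‖X n ω - c‖} := by
    have hs : MeasurableSet {ω | ε ≤ ‖X n ω - c‖} := measurableSet_le measurable_const (hm n)
    have hi : Integrable ({ω | ε ≤ ‖X n ω - c‖}.indicator fun _ => C) P :=
      (integrable_const C).indicator hs
    calc ∫ ω, |X n ω - c| ∂P
        ≤ ∫ ω, (ε + {ω | ε ≤ ‖X n ω - c‖}.indicator (fun _ => C) ω) ∂P := by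
          refine integral_mono
            (Integrable.of_bound (hm n).aestronglyMeasurable C (ae_of_all _ fun ω => ?_))
            ((integrable_const ε).add hi) fun ω => ?_
          · simpa using hC n ω
          · by_cases hω : ε ≤ ‖X n ω - c‖
            · rw [Set.indicator_of_mem (show ω ∈ {ω | ε ≤ ‖X n ω - c‖} from hω)]
              exact (hC n ω).trans (le_add_of_nonneg_left hε.le)
            · rw [Set.indicator_of_notMem (show ω ∉ {ω | ε ≤ ‖X n ω - c‖} from hω), add_zero]
              exact (not_le.1 hω).le
      _ = ε + C * P.real {ω | ε ≤ ‖X n ω - c‖} := by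
          rw [integral_add (integrable_const ε) hi, integral_indicator_const _ hs]
          simp [mul_comm]
  rw [Metric.tendsto_atTop']
  intro ε hε
  have h1 : Tendsto (fun n => ε / 2 + C * P.real {ω | ε / 2 ≤ ‖X n ω - c‖}) atTop
      (𝓝 (ε / 2 + C * 0)) := ((h (ε / 2) (half_pos hε)).const_mul C).const_add _
  obtain ⟨N, hN⟩ := eventually_atTop.1 (h1.eventually_lt_const (u := ε) (by linarith))
  refine ⟨N, fun n hn => ?_⟩
  rw [Real.dist_eq, sub_zero, abs_of_nonneg (integral_nonneg fun _ => abs_nonneg _)]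
  exact (hle _ (half_pos hε) n).trans_lt (hN n hn.le)

/-- Convergence in mean gives convergence in measure for quotients with nonzero limiting
denominator. -/
theorem tendstoInMeasure_div_of_tendsto_integral_abs_sub {Ω : Type*} [MeasurableSpace Ω]
    {P : Measure Ω} [IsFiniteMeasure P] {X Y : ℕ → Ω → ℝ} {a b : ℝ} (hb : b ≠ 0)
    (hX : ∀ n, Integrable (X n) P) (hY : ∀ n, Integrable (Y n) P)
    (hXa : Tendsto (fun n => ∫ ω, |X n ω - a| ∂P) atTop (𝓝 0))
    (hYb : Tendsto (fun n => ∫ ω, |Y n ω - b| ∂P) atTop (𝓝 0)) :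
    TendstoInMeasure P (fun n ω => X n ω / Y n ω) atTop fun _ => a / b := by
  rw [tendstoInMeasure_iff_measureReal_norm]
  intro ε hε
  -- By continuity, a deviation `ε` of the quotient forces a deviation `δ` of `X n` or `Y n`, and
  -- Markov's inequality bounds each.
  have hcont : ContinuousAt (fun p : ℝ × ℝ => p.1 / p.2) (a, b) :=
    continuousAt_fst.div continuousAt_snd hb
  obtain ⟨δ, hδ, hδε⟩ := Metric.continuousAt_iff.1 hcont ε hε
  have hle (n : ℕ) : P.real {ω | ε ≤ ‖X n ω / Y n ω - a / b‖} ≤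
      δ⁻¹ * ∫ ω, |X n ω - a| ∂P + δ⁻¹ * ∫ ω, |Y n ω - b| ∂P := by
    have hmarkov {Z : Ω → ℝ} {c : ℝ} (hZ : Integrable Z P) :
        P.real {ω | δ ≤ |Z ω - c|} ≤ δ⁻¹ * ∫ ω, |Z ω - c| ∂P := by
      rw [← div_eq_inv_mul, le_div_iff₀' hδ]
      exact mul_meas_ge_le_integral_of_nonneg (ae_of_all _ fun _ => abs_nonneg _)
        (hZ.sub (integrable_const c)).abs δ
    refine le_trans ?_ (add_le_add (hmarkov (hX n)) (hmarkov (hY n)))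
    refine le_trans (measureReal_mono ?_) (measureReal_union_le _ _)
    intro ω hω
    by_contra hcon
    simp only [Set.mem_union, Set.mem_ofPred_eq, not_or, not_le] at hcon
    have := hδε (x := (X n ω, Y n ω)) (by
      rw [Prod.dist_eq]
      exact max_lt hcon.1 hcon.2)
    exact (not_le.2 this) hω
  refine squeeze_zero (fun _ => measureReal_nonneg) hle ?_
  simpa using (hXa.const_mul δ⁻¹).add (hYb.const_mul δ⁻¹)

/-- Convergence in mean to a constant implies convergence of the expectations. -/
theorem tendsto_integral_of_tendsto_integral_abs_sub {Ω : Type*} [MeasurableSpace Ω]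
    {P : Measure Ω} [IsProbabilityMeasure P] {X : ℕ → Ω → ℝ} {c : ℝ} (hX : ∀ n, Integrable (X n) P)
    (h : Tendsto (fun n => ∫ ω, |X n ω - c| ∂P) atTop (𝓝 0)) :
    Tendsto (fun n => ∫ ω, X n ω ∂P) atTop (𝓝 c) := by
  rw [tendsto_iff_dist_tendsto_zero]
  refine squeeze_zero (fun _ => dist_nonneg) (fun n => ?_) h
  rw [Real.dist_eq]
  have : (∫ ω, X n ω ∂P) - c = ∫ ω, (X n ω - c) ∂P := by
    rw [integral_sub (hX n) (integrable_const c), integral_const, probReal_univ, one_smul]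
  rw [this]
  exact abs_integral_le_integral_abs

/-- A nonnegative measurable limit of an increasing sequence of functions with bounded integrals
is integrable. -/
theorem integrable_of_tendsto_of_integral_le {Ω : Type*} [MeasurableSpace Ω]
    {P : Measure Ω} {f : ℕ → Ω → ℝ} {F : Ω → ℝ} {C : ℝ}
    (hf : ∀ n, Integrable (f n) P) (hf0 : ∀ n ω, 0 ≤ f n ω) (hfm : ∀ n, Measurable (f n))
    (hlim : ∀ ω, Tendsto (fun n => f n ω) atTop (𝓝 (F ω))) (hC : ∀ n, ∫ ω, f n ω ∂P ≤ C) :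
    Integrable F P := by
  have hF0 (ω : Ω) : 0 ≤ F ω := ge_of_tendsto' (hlim ω) fun n => hf0 n ω
  have hFm : Measurable F := measurable_of_tendsto_metrizable hfm (tendsto_pi_nhds.2 hlim)
  refine ⟨hFm.aestronglyMeasurable, ?_⟩
  rw [hasFiniteIntegral_iff_ofReal (ae_of_all _ hF0)]
  have hle : ∫⁻ ω, ENNReal.ofReal (F ω) ∂P ≤ ENNReal.ofReal C := by
    -- Writing the limit as a liminf allows Fatou's lemma.
    have h1 (ω : Ω) : ENNReal.ofReal (F ω) =
        liminf (fun n => ENNReal.ofReal (f n ω)) atTop :=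
      ((ENNReal.continuous_ofReal.tendsto _).comp (hlim ω)).liminf_eq.symm
    simp_rw [h1]
    refine (lintegral_liminf_le fun n => (hfm n).ennreal_ofReal).trans ?_
    refine liminf_le_of_le (by isBoundedDefault) fun b hb => ?_
    obtain ⟨n, hn⟩ := hb.exists
    refine hn.trans ?_
    rw [← ofReal_integral_eq_lintegral_ofReal (hf n) (ae_of_all _ (hf0 n))]
    exact ENNReal.ofReal_le_ofReal (hC n)
  exact hle.trans_lt ENNReal.ofReal_lt_top

open Classical in
/-- A bounded function is approximated by its restriction to a finite set. -/
theorem abs_sub_sum_le {α : Type*} {φ : α → ℝ} {C : ℝ} (hφ : ∀ x, |φ x| ≤ C) (F : Finset α)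
    (x : α) : |φ x - ∑ s ∈ F, φ s * (if x = s then 1 else 0)| ≤
      C * (1 - ∑ s ∈ F, if x = s then 1 else 0) := by
  simp only [mul_ite, mul_one, mul_zero, Finset.sum_ite_eq]
  split_ifs
  · simp
  · simpa using hφ x

/-! ### Vertex averages of bounded functions of balls. -/

section LocalLimit

variable {Ω Ω' : Type*} [MeasurableSpace Ω] [MeasurableSpace Ω'] {P : Measure Ω}
  [IsProbabilityMeasure P] {P' : Measure Ω'} [IsProbabilityMeasure P']
  {V : ℕ → Type} [∀ n, Fintype (V n)] [∀ n, Nonempty (V n)]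
  {G : ∀ n, Ω → SimpleGraph (V n)} {Gs : Ω' → RootedGraphSpace}

theorem measurable_comp_ball_comp {β : Type*} [MeasurableSpace β] (hGs : Measurable Gs) (r : ℕ)
    (φ : RootedGraphSpace → β) : Measurable fun ω => φ ((Gs ω).ball r) :=
  (RootedGraphSpace.measurable_comp_ball r φ).comp hGs

theorem integrable_comp_ball_of_bound (hGs : Measurable Gs) (r : ℕ) {φ : RootedGraphSpace → ℝ}
    {C : ℝ} (hφ : ∀ x, |φ x| ≤ C) : Integrable (fun ω => φ ((Gs ω).ball r)) P' :=
  Integrable.of_bound (measurable_comp_ball_comp hGs r φ).aestronglyMeasurable C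
    (ae_of_all _ fun _ => hφ _)

/-- Finitely many classes carry almost all the mass of `B_r` of a random rooted graph. -/
theorem exists_finset_finiteClasses (hGs : Measurable Gs) (r : ℕ) {ε : ℝ} (hε : 0 < ε) :
    ∃ F : Finset RootedGraphSpace, (∀ s ∈ F, s ∈ finiteClasses) ∧
      1 - ∑ s ∈ F, P'.real {ω | (Gs ω).ball r = s} ≤ ε := by
  classical
  obtain ⟨ω₀⟩ := nonempty_of_isProbabilityMeasure P'
  obtain ⟨f, hf⟩ := finiteClasses_countable.exists_eq_range ⟨_, ball_mem_finiteClasses (Gs ω₀) r⟩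
  let F : ℕ → Finset RootedGraphSpace := fun n => (Finset.range n).image f
  -- These events increase to the whole space because every ball is finite, so their probabilities
  -- tend to 1.
  let A : ℕ → Set Ω' := fun n => {ω | (Gs ω).ball r ∈ F n}
  have hA : Monotone A := fun m n hmn _ hω =>
    Finset.image_subset_image (Finset.range_mono hmn) hω
  have hU : ⋃ n, A n = Set.univ := by
    refine Set.eq_univ_of_forall fun ω => ?_
    have h := ball_mem_finiteClasses (Gs ω) r
    rw [hf] at h
    obtain ⟨m, hm⟩ := h
    refine Set.mem_iUnion.2 ⟨m + 1, ?_⟩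
    exact Finset.mem_image.2 ⟨m, Finset.self_mem_range_succ m, hm⟩
  have hlim := tendsto_measure_iUnion_atTop (μ := P') hA
  rw [hU] at hlim
  have hlim' : Tendsto (fun n => P'.real (A n)) atTop (𝓝 1) := by
    have := (ENNReal.tendsto_toReal (by simp)).comp hlim
    simpa [measureReal_def, Function.comp_def] using this
  obtain ⟨n, hn⟩ := (hlim'.eventually_const_lt (u := 1 - ε) (by linarith)).exists
  refine ⟨F n, fun s hs => ?_, ?_⟩
  · obtain ⟨m, -, rfl⟩ := Finset.mem_image.1 hs
    rw [hf]
    exact ⟨m, rfl⟩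
  · have hAn : A n = ⋃ s ∈ F n, {ω | (Gs ω).ball r = s} := by
      ext ω
      simp [A]
    rw [hAn, measureReal_biUnion_finset] at hn
    · linarith
    · intro s _ t _ hst
      refine Set.disjoint_left.2 fun ω h1 h2 => hst ?_
      exact (show (Gs ω).ball r = s from h1).symm.trans h2
    · intro s _
      exact hGs (RootedGraphSpace.isOpen_ball_mem r {s}).measurableSet

/-- Local weak convergence in probability gives convergence in mean of the vertex averages of
bounded functions of balls. -/
theorem TendstoLocallyInProbability.tendsto_integral_abs_sub
    (hloc : TendstoLocallyInProbability P P' G Gs) (hG : ∀ n, Measurable (G n))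
    (hGs : Measurable Gs) (r : ℕ) {φ : RootedGraphSpace → ℝ} {C : ℝ} (hφ : ∀ x, |φ x| ≤ C) :
    Tendsto (fun n => ∫ ω, |(𝔼 v, φ (ballClass (G n ω) r v)) -
      ∫ ω', φ ((Gs ω').ball r) ∂P'| ∂P) atTop (𝓝 0) := by
  classical
  let p : RootedGraphSpace → ℝ := fun s => P'.real {ω | (Gs ω).ball r = s}
  let fr : ∀ n, RootedGraphSpace → Ω → ℝ := fun n s ω =>
    𝔼 v, if ballClass (G n ω) r v = s then 1 else 0
  have hC0 : 0 ≤ C := by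
    obtain ⟨ω⟩ := nonempty_of_isProbabilityMeasure P'
    exact (abs_nonneg _).trans (hφ (Gs ω))
  have hint (n : ℕ) (g : SimpleGraph (V n) → ℝ) : Integrable (fun ω => g (G n ω)) P :=
    integrable_comp_simpleGraph (hG n) g
  have hfr (s : RootedGraphSpace) (hs : s ∈ finiteClasses) :
      Tendsto (fun n => ∫ ω, |fr n s ω - p s| ∂P) atTop (𝓝 0) := by
    obtain ⟨H, hH, rfl⟩ := hs
    refine tendsto_integral_abs_sub_of_tendstoInMeasure (C := 1) (fun n => ?_) (fun n ω => ?_) ?_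
    · exact measurable_comp_simpleGraph (hG n)
        (fun K => 𝔼 v, if ballClass K r v = Quotient.mk rootedSetoid H then (1 : ℝ) else 0)
    · have h1 : 0 ≤ fr n (Quotient.mk rootedSetoid H) ω :=
        Finset.expect_nonneg fun v _ => by split_ifs <;> simp
      have h2 : fr n (Quotient.mk rootedSetoid H) ω ≤ 1 :=
        Finset.expect_le Finset.univ_nonempty fun v _ => by split_ifs <;> simp
      have h3 : 0 ≤ p (Quotient.mk rootedSetoid H) := measureReal_nonneg
      have h4 : p (Quotient.mk rootedSetoid H) ≤ 1 := measureReal_le_one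
      rw [abs_le]
      constructor <;> linarith
    · have h := hloc r H hH
      simp_rw [ballFraction_eq_expect] at h
      exact h
  have hexp (F : Finset RootedGraphSpace) :
      |(∫ ω', φ ((Gs ω').ball r) ∂P') - ∑ s ∈ F, φ s * p s| ≤ C * (1 - ∑ s ∈ F, p s) := by
    have hi (s : RootedGraphSpace) :
        Integrable (fun ω => if (Gs ω).ball r = s then (1 : ℝ) else 0) P' :=
      integrable_comp_ball_of_bound hGs r (φ := fun x => if x = s then 1 else 0) (C := 1)
        fun x => by split_ifs <;> simp
    have hp (s : RootedGraphSpace) :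
        p s = ∫ ω, (if (Gs ω).ball r = s then (1 : ℝ) else 0) ∂P' := by
      have hs : MeasurableSet {ω | (Gs ω).ball r = s} :=
        hGs (RootedGraphSpace.isOpen_ball_mem r {s}).measurableSet
      rw [show p s = P'.real {ω | (Gs ω).ball r = s} from rfl, ← integral_indicator_one hs]
      rfl
    have hiφ := integrable_comp_ball_of_bound (P' := P') hGs r hφ
    simp_rw [hp, ← integral_const_mul]
    rw [← integral_finsetSum _ fun s _ => (hi s).const_mul _,
      ← integral_finsetSum _ fun s _ => hi s,
      ← integral_sub hiφ (integrable_finsetSum _ fun s _ => (hi s).const_mul _)]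
    refine abs_integral_le_integral_abs.trans ?_
    have h1 : C * (1 - ∫ ω, ∑ s ∈ F, (if (Gs ω).ball r = s then (1 : ℝ) else 0) ∂P') =
        ∫ ω, C * (1 - ∑ s ∈ F, if (Gs ω).ball r = s then (1 : ℝ) else 0) ∂P' := by
      rw [integral_const_mul,
        integral_sub (integrable_const _) (integrable_finsetSum _ fun s _ => hi s),
        integral_const, probReal_univ, one_smul]
    rw [h1]
    refine integral_mono (hiφ.sub (integrable_finsetSum _ fun s _ => (hi s).const_mul _)).abs
      (((integrable_const _).sub (integrable_finsetSum _ fun s _ => hi s)).const_mul _)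
      fun ω => ?_
    exact abs_sub_sum_le hφ F _
  have havg (F : Finset RootedGraphSpace) (n : ℕ) (ω : Ω) :
      |(𝔼 v, φ (ballClass (G n ω) r v)) - ∑ s ∈ F, φ s * fr n s ω| ≤
        C * (1 - ∑ s ∈ F, fr n s ω) := by
    have h1 : C * (1 - 𝔼 v, ∑ s ∈ F, if ballClass (G n ω) r v = s then (1 : ℝ) else 0) =
        𝔼 v, C * (1 - ∑ s ∈ F, if ballClass (G n ω) r v = s then (1 : ℝ) else 0) := by
      rw [← Finset.mul_expect, Finset.expect_sub_distrib, Finset.expect_const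
        Finset.univ_nonempty]
    simp only [fr]
    simp_rw [Finset.mul_expect]
    rw [← Finset.expect_sum_comm, ← Finset.expect_sum_comm, ← Finset.expect_sub_distrib, h1]
    refine (Finset.abs_expect_le _ _).trans (Finset.expect_le_expect fun v _ => ?_)
    exact abs_sub_sum_le hφ F _
  -- On the classes in `F` the two averages differ by at most `C ∑ |fr - p|`. The two tails off `F`
  -- cost `C` times their missing masses; passing from the empirical missing mass to `1 - ∑ p` costs
  -- another `C ∑ |fr - p|`.
  have hpt (F : Finset RootedGraphSpace) (n : ℕ) (ω : Ω) :
      |(𝔼 v, φ (ballClass (G n ω) r v)) - ∫ ω', φ ((Gs ω').ball r) ∂P'| ≤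
        2 * C * ∑ s ∈ F, |fr n s ω - p s| + 2 * C * (1 - ∑ s ∈ F, p s) := by
    have h1 := havg F n ω
    have h2 := hexp F
    have h3 : |(∑ s ∈ F, φ s * fr n s ω) - ∑ s ∈ F, φ s * p s| ≤
        C * ∑ s ∈ F, |fr n s ω - p s| := by
      rw [← Finset.sum_sub_distrib, Finset.mul_sum]
      refine (Finset.abs_sum_le_sum_abs _ _).trans (Finset.sum_le_sum fun s _ => ?_)
      rw [← mul_sub, abs_mul]
      exact mul_le_mul_of_nonneg_right (hφ s) (abs_nonneg _)
    have h4 : (∑ s ∈ F, p s) - ∑ s ∈ F, fr n s ω ≤ ∑ s ∈ F, |fr n s ω - p s| := by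
      rw [← Finset.sum_sub_distrib]
      exact Finset.sum_le_sum fun s _ => by rw [abs_sub_comm]; exact le_abs_self _
    have h5 := mul_le_mul_of_nonneg_left h4 hC0
    rw [abs_le] at h1 h2 h3 ⊢
    constructor <;> nlinarith [h1.1, h1.2, h2.1, h2.2, h3.1, h3.2]
  rw [Metric.tendsto_atTop']
  intro ε hε
  -- With `C + 1` in place of `C` the denominator is positive even if `C = 0`; the tail term is then
  -- at most `ε / 2`.
  obtain ⟨F, hF, hFε⟩ := exists_finset_finiteClasses (P' := P') hGs r
    (show 0 < ε / (4 * (C + 1)) by positivity)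
  have hsmall : 2 * C * (1 - ∑ s ∈ F, p s) < ε := by
    have h : (C + 1) * (1 - ∑ s ∈ F, p s) ≤ ε / 4 := by
      rw [← le_div_iff₀' (by positivity), div_div]
      exact hFε
    have h0 : 0 ≤ C * (1 - ∑ s ∈ F, p s) := (abs_nonneg _).trans (hexp F)
    by_cases h' : 0 ≤ 1 - ∑ s ∈ F, p s
    · nlinarith
    · nlinarith
  have hlim : Tendsto (fun n => 2 * C * ∑ s ∈ F, ∫ ω, |fr n s ω - p s| ∂P +
      2 * C * (1 - ∑ s ∈ F, p s)) atTop
      (𝓝 (2 * C * ∑ s ∈ F, (0 : ℝ) + 2 * C * (1 - ∑ s ∈ F, p s))) :=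
    ((tendsto_finsetSum F fun s hs => hfr s (hF s hs)).const_mul _).add_const _
  obtain ⟨N, hN⟩ := eventually_atTop.1 (hlim.eventually_lt_const (u := ε) (by simpa using hsmall))
  refine ⟨N, fun n hn => ?_⟩
  rw [Real.dist_eq, sub_zero, abs_of_nonneg (integral_nonneg fun _ => abs_nonneg _)]
  refine lt_of_le_of_lt ?_ (hN n hn.le)
  have hif (s : RootedGraphSpace) : Integrable (fun ω => |fr n s ω - p s|) P :=
    hint n fun K => |(𝔼 v, if ballClass K r v = s then (1 : ℝ) else 0) - p s|
  calc ∫ ω, |(𝔼 v, φ (ballClass (G n ω) r v)) - ∫ ω', φ ((Gs ω').ball r) ∂P'| ∂P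
      ≤ ∫ ω, (2 * C * ∑ s ∈ F, |fr n s ω - p s| + 2 * C * (1 - ∑ s ∈ F, p s)) ∂P :=
        integral_mono
          (hint n fun K => |(𝔼 v, φ (ballClass K r v)) - ∫ ω', φ ((Gs ω').ball r) ∂P'|)
          (((integrable_finsetSum _ fun s _ => hif s).const_mul _).add (integrable_const _))
          fun ω => hpt F n ω
    _ = _ := by
        rw [integral_add ((integrable_finsetSum _ fun s _ => hif s).const_mul _)
          (integrable_const _), integral_const_mul, integral_finsetSum _ fun s _ => hif s]
        simp

end LocalLimit

/-! ### Truncated path counts and squared degrees. -/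

theorem rootDeg_ballClass {V : Type} [Finite V] (G : SimpleGraph V) {r : ℕ} (hr : 1 ≤ r) (v : V) :
    (ballClass G r v).rootDeg = deg G v :=
  deg_rootedBall G _ v hr

theorem homRoot_path_ballClass {V : Type} [Finite V] (G : SimpleGraph V) {r : ℕ} (hr : 2 ≤ r)
    (v : V) : (ballClass G r v).homRoot (SimpleGraph.pathGraph 3) 0 =
      homRooted (SimpleGraph.pathGraph 3) 0 G v :=
  homRooted_path_rootedBall G _ v hr

namespace RootedGraphSpace

/-- The number of rooted paths on three vertices starting at a root of degree `k`. -/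
noncomputable def pathCount (k : ℕ) (x : RootedGraphSpace) : ℝ :=
  if x.rootDeg = k then (x.homRoot (SimpleGraph.pathGraph 3) 0 : ℝ) else 0

/-- The truncation of `pathCount` at `k * M`. -/
noncomputable def truncPathCount (k M : ℕ) (x : RootedGraphSpace) : ℝ :=
  if x.rootDeg = k then min (x.homRoot (SimpleGraph.pathGraph 3) 0 : ℝ) (k * M) else 0

/-- The squared degree of the root, if the degree is at most `M`. -/
noncomputable def truncSqDeg (M : ℕ) (x : RootedGraphSpace) : ℝ :=
  if x.rootDeg ≤ M then (x.rootDeg : ℝ) ^ 2 else 0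

theorem pathCount_ball (k : ℕ) (x : RootedGraphSpace) :
    (x.ball 2).pathCount k = x.pathCount k := by
  rw [pathCount, pathCount, rootDeg_ball x one_le_two, homRoot_path_ball x le_rfl]

theorem truncPathCount_nonneg (k M : ℕ) (x : RootedGraphSpace) : 0 ≤ x.truncPathCount k M := by
  unfold truncPathCount
  split_ifs <;> positivity

theorem truncPathCount_le_pathCount (k M : ℕ) (x : RootedGraphSpace) :
    x.truncPathCount k M ≤ x.pathCount k := by
  unfold truncPathCount pathCount
  split_ifs
  · exact min_le_left _ _
  · exact le_rfl

theorem abs_truncPathCount_le (k M : ℕ) (x : RootedGraphSpace) :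
    |x.truncPathCount k M| ≤ k * M := by
  rw [abs_of_nonneg (truncPathCount_nonneg k M x)]
  unfold truncPathCount
  split_ifs
  · exact min_le_right _ _
  · positivity

theorem truncPathCount_mono (k : ℕ) (x : RootedGraphSpace) :
    Monotone fun M => x.truncPathCount k M := by
  intro M N h
  simp only [truncPathCount]
  split_ifs
  · gcongr
  · exact le_rfl

/-- The sequence is eventually constant: as `k ≥ 1`, the level `k * M` passes the path count. -/
theorem tendsto_truncPathCount {k : ℕ} (hk : 1 ≤ k) (x : RootedGraphSpace) :
    Tendsto (fun M => x.truncPathCount k M) atTop (𝓝 (x.pathCount k)) := by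
  refine tendsto_const_nhds.congr' ?_
  filter_upwards [eventually_ge_atTop (x.homRoot (SimpleGraph.pathGraph 3) 0)] with M hM
  have h : x.homRoot (SimpleGraph.pathGraph 3) 0 ≤ k * M :=
    hM.trans (Nat.le_mul_of_pos_left M hk)
  have h' : (x.homRoot (SimpleGraph.pathGraph 3) 0 : ℝ) ≤ k * M := by exact_mod_cast h
  rw [pathCount, truncPathCount, min_eq_left h']

theorem truncSqDeg_nonneg (M : ℕ) (x : RootedGraphSpace) : 0 ≤ x.truncSqDeg M := by
  unfold truncSqDeg
  split_ifs <;> positivity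

theorem truncSqDeg_le (M : ℕ) (x : RootedGraphSpace) : x.truncSqDeg M ≤ (x.rootDeg : ℝ) ^ 2 := by
  unfold truncSqDeg
  split_ifs
  · exact le_rfl
  · positivity

theorem abs_truncSqDeg_le (M : ℕ) (x : RootedGraphSpace) : |x.truncSqDeg M| ≤ (M : ℝ) ^ 2 := by
  rw [abs_of_nonneg (truncSqDeg_nonneg M x)]
  unfold truncSqDeg
  split_ifs with h
  · gcongr
  · positivity

theorem tendsto_truncSqDeg (x : RootedGraphSpace) :
    Tendsto (fun M => x.truncSqDeg M) atTop (𝓝 ((x.rootDeg : ℝ) ^ 2)) := by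
  refine tendsto_const_nhds.congr' ?_
  filter_upwards [eventually_ge_atTop x.rootDeg] with M hM
  rw [truncSqDeg, if_pos hM]

end RootedGraphSpace

open RootedGraphSpace

theorem expect_truncPathCount_le {V : Type} [Fintype V] (k M : ℕ) (G : SimpleGraph V) :
    (𝔼 v, (ballClass G 2 v).truncPathCount k M) ≤ 𝔼 v, (ballClass G 2 v).pathCount k :=
  Finset.expect_le_expect fun _ _ => truncPathCount_le_pathCount _ _ _

/-- The last bracket is the mean of `d² 1_{d>M}`; this is how the second moment controls the
unbounded path count. -/
theorem expect_pathCount_le {V : Type} [Fintype V] (k M : ℕ) (G : SimpleGraph V) :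
    (𝔼 v, (ballClass G 2 v).pathCount k) ≤ (𝔼 v, (ballClass G 2 v).truncPathCount k M) +
      ((𝔼 v, (deg G v : ℝ) ^ 2) - 𝔼 v, (ballClass G 2 v).truncSqDeg M) := by
  classical
  rw [← sub_le_iff_le_add', ← Finset.expect_sub_distrib, ← Finset.expect_sub_distrib,
    Fintype.expect_eq_sum_div_card, Fintype.expect_eq_sum_div_card]
  refine div_le_div_of_nonneg_right (le_trans (le_of_eq ?_)
    ((sum_homRooted_sub_min_le k M G).trans (le_of_eq ?_))) (Nat.cast_nonneg _)
  · refine Finset.sum_congr rfl fun v _ => ?_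
    rw [pathCount, truncPathCount, rootDeg_ballClass G one_le_two,
      homRoot_path_ballClass G le_rfl]
    split_ifs <;> simp
  · refine Finset.sum_congr rfl fun v _ => ?_
    rw [truncSqDeg, rootDeg_ballClass G one_le_two]

/-! ### Removing the truncation. -/

section LocalLimit

variable {Ω Ω' : Type*} [MeasurableSpace Ω] [MeasurableSpace Ω'] {P : Measure Ω}
  [IsProbabilityMeasure P] {P' : Measure Ω'} [IsProbabilityMeasure P']
  {V : ℕ → Type} [∀ n, Fintype (V n)] [∀ n, Nonempty (V n)]
  {G : ∀ n, Ω → SimpleGraph (V n)} {Gs : Ω' → RootedGraphSpace}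

/-- Under local weak convergence in probability with convergence of the second moment of the
degree, the vertex average of `pathCount` converges in mean. -/
theorem TendstoLocallyInProbability.tendsto_integral_abs_sub_pathCount
    (hloc : TendstoLocallyInProbability P P' G Gs) (hG : ∀ n, Measurable (G n))
    (hGs : Measurable Gs) (hfin : Integrable (fun ω => ((Gs ω).rootDeg : ℝ) ^ 2) P')
    (hmom : Tendsto (fun n => ∫ ω, (𝔼 v : V n, (deg (G n ω) v : ℝ) ^ 2) ∂P) atTop
      (𝓝 (∫ ω, ((Gs ω).rootDeg : ℝ) ^ 2 ∂P'))) {k : ℕ} (hk : 1 ≤ k) :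
    Integrable (fun ω => (Gs ω).pathCount k) P' ∧
    Tendsto (fun n => ∫ ω, |(𝔼 v, (ballClass (G n ω) 2 v).pathCount k) -
      ∫ ω', (Gs ω').pathCount k ∂P'| ∂P) atTop (𝓝 0) := by
  have hint (n : ℕ) (g : SimpleGraph (V n) → ℝ) : Integrable (fun ω => g (G n ω)) P :=
    integrable_comp_simpleGraph (hG n) g
  let m : ℕ → ℝ := fun M => ∫ ω, ((Gs ω).ball 2).truncPathCount k M ∂P'
  let q : ℕ → ℝ := fun M => ∫ ω, ((Gs ω).ball 2).truncSqDeg M ∂P'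
  have hcount (M : ℕ) : Tendsto (fun n => ∫ ω, |(𝔼 v, (ballClass (G n ω) 2 v).truncPathCount k M) -
      m M| ∂P) atTop (𝓝 0) :=
    hloc.tendsto_integral_abs_sub hG hGs 2 (abs_truncPathCount_le k M)
  have hdeg (M : ℕ) : Tendsto (fun n => ∫ ω, (𝔼 v, (ballClass (G n ω) 2 v).truncSqDeg M) ∂P) atTop
      (𝓝 (q M)) :=
    tendsto_integral_of_tendsto_integral_abs_sub
      (fun n => hint n fun K => 𝔼 v, (ballClass K 2 v).truncSqDeg M)
      (hloc.tendsto_integral_abs_sub hG hGs 2 (abs_truncSqDeg_le M))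
  have hmi (M : ℕ) : Integrable (fun ω => ((Gs ω).ball 2).truncPathCount k M) P' :=
    integrable_comp_ball_of_bound hGs 2 (abs_truncPathCount_le k M)
  have hmle (M : ℕ) : m M ≤ ∫ ω, ((Gs ω).rootDeg : ℝ) ^ 2 ∂P' := by
    refine le_of_tendsto_of_tendsto' (tendsto_integral_of_tendsto_integral_abs_sub
      (fun n => hint n fun K => 𝔼 v, (ballClass K 2 v).truncPathCount k M) (hcount M)) hmom
      fun n => ?_
    refine integral_mono (hint n fun K => 𝔼 v, (ballClass K 2 v).truncPathCount k M)
      (hint n fun K => 𝔼 v, (deg K v : ℝ) ^ 2) fun ω => ?_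
    -- Truncation level 0 leaves the full second moment as a bound, uniform in `M`.
    refine (expect_truncPathCount_le k M _).trans ((expect_pathCount_le k 0 _).trans ?_)
    have h1 : (𝔼 v, (ballClass (G n ω) 2 v).truncPathCount k 0) ≤ 0 :=
      (Finset.expect_le_expect (g := fun _ => (0 : ℝ)) fun v _ => by
        simpa using (le_abs_self _).trans (abs_truncPathCount_le k 0 (ballClass (G n ω) 2 v))).trans
        (by simp)
    have h2 : 0 ≤ 𝔼 v, (ballClass (G n ω) 2 v).truncSqDeg 0 :=
      Finset.expect_nonneg fun v _ => truncSqDeg_nonneg _ _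
    linarith
  have hptlim (ω : Ω') : Tendsto (fun M => ((Gs ω).ball 2).truncPathCount k M) atTop
      (𝓝 ((Gs ω).pathCount k)) := by
    rw [← pathCount_ball]
    exact tendsto_truncPathCount hk _
  have hI : Integrable (fun ω => (Gs ω).pathCount k) P' :=
    integrable_of_tendsto_of_integral_le hmi (fun M ω => truncPathCount_nonneg _ _ _)
      (fun M => measurable_comp_ball_comp hGs 2 fun x => x.truncPathCount k M) hptlim hmle
  refine ⟨hI, ?_⟩
  set a : ℝ := ∫ ω', (Gs ω').pathCount k ∂P' with ha
  have hma : Tendsto m atTop (𝓝 a) :=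
    integral_tendsto_of_tendsto_of_monotone hmi hI
      (ae_of_all _ fun ω => truncPathCount_mono k _) (ae_of_all _ hptlim)
  have hq : Tendsto q atTop (𝓝 (∫ ω, ((Gs ω).rootDeg : ℝ) ^ 2 ∂P')) := by
    refine tendsto_integral_of_dominated_convergence _ (fun M => ?_) hfin
      (fun M => ae_of_all _ fun ω => ?_) (ae_of_all _ fun ω => ?_)
    · exact (measurable_comp_ball_comp hGs 2 fun x => x.truncSqDeg M).aestronglyMeasurable
    · rw [Real.norm_of_nonneg (truncSqDeg_nonneg _ _), ← rootDeg_ball (Gs ω) one_le_two]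
      exact truncSqDeg_le _ _
    · rw [← rootDeg_ball (Gs ω) one_le_two]
      exact tendsto_truncSqDeg _
  -- Three errors: truncating in `G n`, convergence of the truncated average, and truncating in the
  -- limit.
  have hbound (M n : ℕ) : ∫ ω, |(𝔼 v, (ballClass (G n ω) 2 v).pathCount k) - a| ∂P ≤
      ((∫ ω, (𝔼 v, (deg (G n ω) v : ℝ) ^ 2) ∂P) -
        ∫ ω, (𝔼 v, (ballClass (G n ω) 2 v).truncSqDeg M) ∂P) +
      (∫ ω, |(𝔼 v, (ballClass (G n ω) 2 v).truncPathCount k M) - m M| ∂P) + |m M - a| := by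
    have i1 := hint n fun K => 𝔼 v, (deg K v : ℝ) ^ 2
    have i2 := hint n fun K => 𝔼 v, (ballClass K 2 v).truncSqDeg M
    have i3 := hint n fun K => |(𝔼 v, (ballClass K 2 v).truncPathCount k M) - m M|
    have i4 : Integrable (fun ω => (𝔼 v, (deg (G n ω) v : ℝ) ^ 2) -
        𝔼 v, (ballClass (G n ω) 2 v).truncSqDeg M) P := i1.sub i2
    have i5 : Integrable (fun ω => ((𝔼 v, (deg (G n ω) v : ℝ) ^ 2) -
        𝔼 v, (ballClass (G n ω) 2 v).truncSqDeg M) +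
        |(𝔼 v, (ballClass (G n ω) 2 v).truncPathCount k M) - m M|) P := i4.add i3
    have hc : |m M - a| = ∫ _, |m M - a| ∂P := by simp
    rw [hc, ← integral_sub i1 i2, ← integral_add i4 i3,
      ← integral_add i5 (integrable_const _)]
    refine integral_mono (hint n fun K => |(𝔼 v, (ballClass K 2 v).pathCount k) - a|)
      (i5.add (integrable_const _)) fun ω => ?_
    have h1 := expect_truncPathCount_le k M (G n ω)
    have h2 := expect_pathCount_le k M (G n ω)
    have h3 := abs_le.1 (le_refl |(𝔼 v, (ballClass (G n ω) 2 v).truncPathCount k M) - m M|)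
    have h4 := abs_le.1 (le_refl |m M - a|)
    rw [abs_le]
    constructor <;> linarith [h3.1, h3.2, h4.1, h4.2]
  rw [Metric.tendsto_atTop']
  intro ε hε
  -- This is the limit of `hbound` as `n → ∞` for fixed `M`, with `0` coming from `hcount`; hence
  -- `M` is chosen before `n`.
  have hM : Tendsto (fun M => ((∫ ω, ((Gs ω).rootDeg : ℝ) ^ 2 ∂P') - q M) + 0 + |m M - a|) atTop
      (𝓝 0) := by
    have h := ((hq.const_sub (∫ ω, ((Gs ω).rootDeg : ℝ) ^ 2 ∂P')).add_const 0).add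
      (hma.sub_const a).abs
    rwa [sub_self, sub_self, abs_zero, add_zero, add_zero] at h
  obtain ⟨M, hMε⟩ := (hM.eventually_lt_const hε).exists
  have hlim := ((hmom.sub (hdeg M)).add (hcount M)).add_const |m M - a|
  obtain ⟨N, hN⟩ := eventually_atTop.1 (hlim.eventually_lt_const hMε)
  refine ⟨N, fun n hn => ?_⟩
  rw [Real.dist_eq, sub_zero, abs_of_nonneg (integral_nonneg fun _ => abs_nonneg _)]
  exact (hbound M n).trans_lt (hN n hn.le)

end LocalLimit

end LocalWeak

/-! ### The limit of the conditional assortativity. -/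

theorem mainTheorem7
    {Ω Ω' : Type*} [MeasurableSpace Ω] [MeasurableSpace Ω']
    (P : Measure Ω) [IsProbabilityMeasure P] (P' : Measure Ω') [IsProbabilityMeasure P']
    (V : ℕ → Type) [∀ n, Fintype (V n)]
    (hV : ∀ n, 3 ≤ Fintype.card (V n))
    (hVtop : Tendsto (fun n => Fintype.card (V n)) atTop atTop)
    (G : ∀ n, Ω → SimpleGraph (V n)) (hG : ∀ n, Measurable (G n))
    (Gs : Ω' → LocalWeak.RootedGraphSpace) (hGs : Measurable Gs)
    (hloc : LocalWeak.TendstoLocallyInProbability P P' G Gs)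
    (hfin : Integrable (fun ω => ((Gs ω).rootDeg : ℝ) ^ 2) P')
    -- `E d_n² → E (d*)²`, where `d_n` is the degree of a uniformly random vertex of `G_n`
    (hmom : Tendsto
      (fun n => ∫ ω, (𝔼 v : V n, (LocalWeak.deg (G n ω) v : ℝ) ^ 2) ∂P) atTop
      (𝓝 (∫ ω, ((Gs ω).rootDeg : ℝ) ^ 2 ∂P')))
    (k : ℕ) (hk : 1 ≤ k)
    (hpos : 0 < P' {ω | (Gs ω).rootDeg = k}) :
    -- `P₃'` is the path on three vertices rooted at an endpoint
    Integrable ({ω | (Gs ω).rootDeg = k}.indicator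
      fun ω => ((Gs ω).homRoot (SimpleGraph.pathGraph 3) 0 : ℝ)) P' ∧
    Integrable ({ω | (Gs ω).rootDeg = k}.indicator
      fun ω => ((Gs ω).embRoot (SimpleGraph.pathGraph 3) 0 : ℝ)) P' ∧
    TendstoInMeasure P (fun n ω => LocalWeak.condAssortativity k (G n ω)) atTop
      (fun _ => (∫ ω, {ω | (Gs ω).rootDeg = k}.indicator
        (fun ω => ((Gs ω).homRoot (SimpleGraph.pathGraph 3) 0 : ℝ)) ω ∂P') /
          (k * P'.real {ω | (Gs ω).rootDeg = k})) ∧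
    (∫ ω, {ω | (Gs ω).rootDeg = k}.indicator
        (fun ω => ((Gs ω).homRoot (SimpleGraph.pathGraph 3) 0 : ℝ)) ω ∂P') /
          (k * P'.real {ω | (Gs ω).rootDeg = k}) =
      1 + (∫ ω, {ω | (Gs ω).rootDeg = k}.indicator
        (fun ω => ((Gs ω).embRoot (SimpleGraph.pathGraph 3) 0 : ℝ)) ω ∂P') /
          (k * P'.real {ω | (Gs ω).rootDeg = k}) := by
  classical
  have hne (n : ℕ) : Nonempty (V n) :=
    Fintype.card_pos_iff.1 ((by norm_num : 0 < 3).trans_le (hV n))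
  have hind : ({ω | (Gs ω).rootDeg = k}.indicator
      fun ω => ((Gs ω).homRoot (SimpleGraph.pathGraph 3) 0 : ℝ)) =
      fun ω => (Gs ω).pathCount k := by
    ext ω
    simp only [Set.indicator, Set.mem_ofPred_eq, LocalWeak.RootedGraphSpace.pathCount]
  have hmeas : MeasurableSet {ω | (Gs ω).rootDeg = k} := by
    have h := LocalWeak.measurable_comp_ball_comp hGs 2 LocalWeak.RootedGraphSpace.rootDeg
      (measurableSet_singleton k)
    simp only [LocalWeak.RootedGraphSpace.rootDeg_ball _ one_le_two] at h
    exact h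
  have hp : 0 < P'.real {ω | (Gs ω).rootDeg = k} :=
    ENNReal.toReal_pos hpos.ne' (measure_ne_top _ _)
  have hk0 : (0 : ℝ) < k := by exact_mod_cast hk
  obtain ⟨hI, hnum⟩ := hloc.tendsto_integral_abs_sub_pathCount hG hGs hfin hmom hk
  -- At a root of degree `k`, exactly `k` homomorphisms are non-injective; divided by `k P(d* = k)`,
  -- their expectation is the `1` in the second formula.
  have hemb : ({ω | (Gs ω).rootDeg = k}.indicator
      fun ω => ((Gs ω).embRoot (SimpleGraph.pathGraph 3) 0 : ℝ)) =
      fun ω => (Gs ω).pathCount k - {ω | (Gs ω).rootDeg = k}.indicator (fun _ => (k : ℝ)) ω := by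
    ext ω
    simp only [Set.indicator, Set.mem_ofPred_eq, LocalWeak.RootedGraphSpace.pathCount,
      LocalWeak.RootedGraphSpace.homRoot_path_eq]
    split_ifs with h
    · rw [h]; push_cast; ring
    · simp
  have hIk : Integrable ({ω | (Gs ω).rootDeg = k}.indicator fun _ => (k : ℝ)) P' :=
    (integrable_const _).indicator hmeas
  rw [hind, hemb]
  refine ⟨hI, hI.sub hIk, ?_, ?_⟩
  · let δ : LocalWeak.RootedGraphSpace → ℝ := fun x => if x.rootDeg = k then 1 else 0
    have hδ : ∫ ω, δ ((Gs ω).ball 2) ∂P' = P'.real {ω | (Gs ω).rootDeg = k} := by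
      rw [← integral_indicator_one hmeas]
      refine integral_congr_ae (ae_of_all _ fun ω => ?_)
      simp only [δ, LocalWeak.RootedGraphSpace.rootDeg_ball _ one_le_two, Set.indicator,
        Set.mem_ofPred_eq, Pi.one_apply]
    have hden := hloc.tendsto_integral_abs_sub hG hGs 2 (φ := fun x => k * δ x) (C := k)
      fun x => by
        simp only [δ]
        split_ifs <;> simp
    rw [integral_const_mul, hδ] at hden
    -- The factor `k` is kept inside the denominator's average, whose limit `k P(d* = k)` is
    -- nonzero.
    refine (LocalWeak.tendstoInMeasure_div_of_tendsto_integral_abs_sub (mul_pos hk0 hp).ne'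
      (fun n => LocalWeak.integrable_comp_simpleGraph (hG n)
        fun K => 𝔼 v, (LocalWeak.ballClass K 2 v).pathCount k)
      (fun n => LocalWeak.integrable_comp_simpleGraph (hG n)
        fun K => 𝔼 v, k * δ (LocalWeak.ballClass K 2 v)) hnum hden).congr_left
      fun n => ae_of_all _ fun ω => ?_
    simp only [LocalWeak.condAssortativity_eq (hV n), δ, LocalWeak.RootedGraphSpace.pathCount,
      LocalWeak.rootDeg_ballClass _ one_le_two, LocalWeak.homRoot_path_ballClass _ le_rfl,
      Finset.mul_expect]
  · rw [integral_sub hI hIk, integral_indicator_const _ hmeas, smul_eq_mul]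
    field_simp
    ring
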